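/- Let $\alpha\in[0,1)$ be irrational and let $s_\alpha$ be a Sturmian word of angle $\alpha$ over $\{a,b\}$. That is, for some initial point $\rho\in[0,1)$, $s_\alpha=a_0a_1a_2\cdots$, where $a_n=b$ if $\{\rho+n\alpha\}\in I_b$ and $a_n=a$ if $\{\rho+n\alpha\}\in I_a$; here either $I_b=[0,1-\alpha)$ and $I_a=[1-\alpha,1)$, or $I_b=(0,1-\alpha]$ and $I_a=(1-\alpha,1]$ (the points $0$ and $1$ of the circle being identified). Then $s_\alpha$ has bounded exponent if and only if $s_\alpha$ is uniformly abelian-square-rich. Moreover, $s_\alpha$ has bounded exponent if and only if $\alpha$ has bounded partial quotients, and if and only if $s_\alpha$ is linearly recurrent. Here an infinite word $w$ has *bounded exponent* if there is an integer $k\ge 2$ such that no factor of $w$ is of the form $u^k$ with $u$ a nonempty word. An *abelian square* is a nonempty word $v_1v_2$ such that every letter occurs equally often in $v_1$ and in $v_2$. The word $w$ is *uniformly abelian-square-rich* if there are a constant $C>0$ and an integer $N$ such that every factor $v$ of $w$ of length $|v|\ge N$ contains at least $C|v|^2$ distinct abelian squares as factors. The number $\alpha$ has *bounded partial quotients* if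 the sequence $(a_i)_{i\ge 0}$ in its simple continued fraction expansion $\alpha=[a_0;a_1,a_2,\ldots]$ is bounded. Finally, $w$ is *linearly recurrent* if, writing $R_w(n)$ for the least $m$ such that every factor of $w$ of length $m$ contains all factors of $w$ of length $n$ ($+\infty$ if there is none), $R_w(n)$ is finite for every $n$ and $R_w(n)/n$ is bounded over $n\ge 1$. -/

import Mathlib

namespace AbSq

section Words

variable {A : Type*}

/-- The word `w i, w (i+1), …, w (i+n-1)` occurring in the infinite word `w` at position `i`. -/
def block (w : ℕ → A) (i n : ℕ) : List A :=
  (List.range n).map fun j => w (i + j)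

/-- `u` is a (possibly empty) factor of the infinite word `w`. Factors of finite words are
given by `u <:+: v`. -/
def IsFactor (u : List A) (w : ℕ → A) : Prop :=
  ∃ i n, u = block w i n

/-- `v = u^k` for some nonempty word `u`. -/
def IsPower (k : ℕ) (v : List A) : Prop :=
  ∃ u : List A, u ≠ [] ∧ v = (List.replicate k u).flatten

/-- No factor of `w` is a `k`-power. -/
def PowerFree (k : ℕ) (w : ℕ → A) : Prop :=
  ∀ v, IsFactor v w → ¬ IsPower k v

/-- `w` is `k`-power-free for some integer `k ≥ 2`. -/
def BoundedExponent (w : ℕ → A) : Prop :=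
  ∃ k : ℕ, 2 ≤ k ∧ PowerFree k w

/-- Every factor of `w` of length `m` contains all the factors of `w` of length `n`. -/
def FactorsContain (w : ℕ → A) (m n : ℕ) : Prop :=
  ∀ v, IsFactor v w → v.length = m → ∀ u, IsFactor u w → u.length = n → u <:+: v

/-- The recurrence index `R_w(n)`: the least `m` such that every factor of length `m` contains
all the factors of length `n`, or `⊤` if there is none. -/
noncomputable def recurrenceIndex (w : ℕ → A) (n : ℕ) : ℕ∞ :=
  sInf ((fun m : ℕ => (m : ℕ∞)) '' {m | FactorsContain w m n})

def UniformlyRecurrent (w : ℕ → A) : Prop :=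
  ∀ n, recurrenceIndex w n ≠ ⊤

/-- `w` is uniformly recurrent and the ratio `R_w(n) / n`, `n ≥ 1`, is bounded. -/
def LinearlyRecurrent (w : ℕ → A) : Prop :=
  UniformlyRecurrent w ∧
    ∃ K : ℕ, ∀ n : ℕ, 1 ≤ n → recurrenceIndex w n ≤ (K : ℕ∞) * (n : ℕ∞)

variable [DecidableEq A]

/-- The Parikh vector of a word. -/
def parikh (v : List A) : A → ℕ := fun x => v.count x

/-- A nonempty word `v₁v₂` where `v₁` and `v₂` have the same Parikh vector. -/
def IsAbelianSquare (v : List A) : Prop :=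
  v ≠ [] ∧ ∃ v₁ v₂ : List A, v = v₁ ++ v₂ ∧ parikh v₁ = parikh v₂

/-- The abelian-square factors of length `m` of the finite word `v`. -/
def abelianSquareFactors (v : List A) (m : ℕ) : Set (List A) :=
  {u | u <:+: v ∧ IsAbelianSquare u ∧ u.length = m}

theorem finite_abelianSquareFactors (v : List A) (m : ℕ) :
    (abelianSquareFactors v m).Finite :=
  (List.finite_toSet v.sublists).subset fun _ hu => List.mem_sublists.2 hu.1.sublist

/-- The number of distinct abelian-square factors of length `m` of the finite word `v`. -/
noncomputable def abelianSquareCountLength (v : List A) (m : ℕ) : ℕ :=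
  (abelianSquareFactors v m).ncard

/-- The number of distinct abelian-square factors, of all lengths, of the finite word `v`. -/
noncomputable def abelianSquareCount (v : List A) : ℕ :=
  ∑ m ∈ Finset.range (v.length + 1), abelianSquareCountLength v m

/-- There is `C > 0` such that every sufficiently long factor `v` of `w` contains at least
`C |v|²` distinct abelian squares. (Words of length `1` contain no abelian square, so the bound
can only be required of the factors from some length on.) -/
def UniformlyAbelianSquareRich (w : ℕ → A) : Prop :=
  ∃ C : ℝ, 0 < C ∧ ∃ N : ℕ, ∀ v, IsFactor v w → N ≤ v.length →
    C * (v.length : ℝ) ^ 2 ≤ (abelianSquareCount v : ℝ)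

end Words

section Sturmian

/-- The binary alphabet `{a, b}`. -/
inductive Letter : Type
  | a
  | b
  deriving DecidableEq

open Classical in
/-- The Sturmian word `s_{α,ρ}`: the coding of the rotation by `α` of the point `ρ` with
`I_b = [0, 1 - α)` and `I_a = [1 - α, 1)`. -/
noncomputable def sturmianLower (α ρ : ℝ) (n : ℕ) : Letter :=
  if Int.fract (ρ + n * α) ∈ Set.Ico 0 (1 - α) then Letter.b else Letter.a

open Classical in
/-- The Sturmian word `s'_{α,ρ}`: the coding of the rotation by `α` of the point `ρ` with
`I_b = (0, 1 - α]` and `I_a = (1 - α, 1]`, where `0` and `1` are the same point of the circle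
(so that the fractional part `0` lies in `I_a`). -/
noncomputable def sturmianUpper (α ρ : ℝ) (n : ℕ) : Letter :=
  if Int.fract (ρ + n * α) ∈ Set.Ioc 0 (1 - α) then Letter.b else Letter.a

/-- `w` is a Sturmian word of angle `α`, with any initial point `ρ` and either choice of the
intervals. -/
def IsSturmianOfAngle (w : ℕ → Letter) (α : ℝ) : Prop :=
  Irrational α ∧ α ∈ Set.Ico (0 : ℝ) 1 ∧
    ∃ ρ ∈ Set.Ico (0 : ℝ) 1, w = sturmianLower α ρ ∨ w = sturmianUpper α ρ

/-- The partial quotients `a₀ = ⌊α⌋` (the head) and `a₁, a₂, …` (the partial denominators) of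
the simple continued fraction expansion of `α` are bounded. -/
def BoundedPartialQuotients (α : ℝ) : Prop :=
  ∃ B : ℝ, (GenContFract.of α).h ≤ B ∧
    ∀ (i : ℕ) (q : ℝ), (GenContFract.of α).partDens.get? i = some q → q ≤ B

end Sturmian

end AbSq

/-! All conditions are compared with one arithmetic property: `α` is badly approximable, i.e. `n‖nα‖
≥ c > 0`. For irrational `α` this amounts to bounded partial quotients, because the error of a
convergent `p_i/q_i` is of order `1/(a_{i+1} q_i²)` and, by Legendre, a very good approximation is a
convergent.

The word is read through a rounding `F` (floor or ceiling): the number of letters `a` in a block is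
the increment of `F` along the unreduced orbit `ρ + nα`. A period `n` over a long stretch then says
that `F` does not see the shift by `nα - p` there, so high powers correspond to values of `nα - p`
tiny compared with `1/n`.

For badly approximable `α`, any `N` consecutive orbit points meet every arc of length `4/(cN)`
(`BadlyApproximableWith.exists_mem_arc`), while the cut points of the blocks of length `n` are
`c/n`-separated (`BadlyApproximableWith.increments_eq`). This gives linear recurrence. It also gives
about `m` abelian squares of length `2m` whenever `mα` is within `1/4` of an integer; such `m` have
bounded gaps, and linear recurrence puts about `L²` of these squares in every factor of length `L`.

Conversely, a high power has too few factors for richness, in any word, and in a linearly recurrent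
word it would force `nα = p`. -/

namespace AbSq

/-! ### Badly approximable numbers, partial quotients, and spacing of rotation orbits -/

section DiophantineApproximation

/-- `n * ‖n * α‖ ≥ c` for all `n ≥ 1`, where `‖x‖` is the distance of `x` to the nearest integer. -/
def BadlyApproximableWith (α c : ℝ) : Prop :=
  ∀ n : ℕ, 1 ≤ n → ∀ p : ℤ, c ≤ n * |n * α - p|

/-- `α` is badly approximable: `n * ‖n * α‖` is bounded away from `0`. -/
def BadlyApproximable (α : ℝ) : Prop :=
  ∃ c : ℝ, 0 < c ∧ BadlyApproximableWith α c

theorem BadlyApproximableWith.div_le {α c : ℝ} (h : BadlyApproximableWith α c) {n : ℕ}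
    (hn : 1 ≤ n) (p : ℤ) : c / n ≤ |n * α - p| := by
  have hn' : (0 : ℝ) < n := by exact_mod_cast hn
  rw [div_le_iff₀ hn', mul_comm]
  exact h n hn p

theorem mul_abs_mul_sub_eq {n : ℝ} (hn : 0 < n) (α p : ℝ) :
    n * |n * α - p| = n ^ 2 * |α - p / n| := by
  have e : n * α - p = n * (α - p / n) := by field_simp
  rw [e, abs_mul, abs_of_pos hn]
  ring

theorem exists_int_contsAux (α : ℝ) (n : ℕ) :
    ∃ a b : ℤ, (GenContFract.of α).contsAux n = ⟨a, b⟩ := by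
  induction n using Nat.strong_induction_on with
  | _ n ih =>
    match n with
    | 0 => exact ⟨1, 0, by simp [GenContFract.contsAux]⟩
    | 1 => exact ⟨⌊α⌋, 1, by simp [GenContFract.contsAux]⟩
    | n + 2 =>
      obtain ⟨a, b, h⟩ := ih n (by omega)
      obtain ⟨a', b', h'⟩ := ih (n + 1) (by omega)
      rcases hs : (GenContFract.of α).s.get? n with _ | gp
      · exact ⟨a', b', by rw [← h']; simp [GenContFract.contsAux, hs]⟩
      · obtain ⟨h1, z, hz⟩ := GenContFract.of_partNum_eq_one_and_exists_int_partDen_eq hs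
        refine ⟨z * a' + a, z * b' + b, ?_⟩
        rw [GenContFract.contsAux_recurrence hs h h', h1, hz]
        push_cast
        simp

theorem one_le_dens (α : ℝ) (n : ℕ) : 1 ≤ (GenContFract.of α).dens n := by
  induction n with
  | zero => simp
  | succ n ih => exact ih.trans GenContFract.of_den_mono

theorem not_terminatedAt_of_irrational {α : ℝ} (hα : Irrational α) (n : ℕ) :
    ¬ (GenContFract.of α).TerminatedAt n := by
  intro h
  obtain ⟨q, hq⟩ := (GenContFract.terminates_iff_rat α).1 ⟨n, h⟩
  exact hα ⟨q, hq.symm⟩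

/-- The numerators and denominators of the convergents are coprime integers. -/
theorem exists_coprime_nums_dens {α : ℝ} (hα : Irrational α) (n : ℕ) :
    ∃ a b : ℤ, (GenContFract.of α).nums n = a ∧ (GenContFract.of α).dens n = b ∧
      IsCoprime a b := by
  obtain ⟨a, b, h⟩ := exists_int_contsAux α (n + 1)
  obtain ⟨a', b', h'⟩ := exists_int_contsAux α (n + 2)
  have hdet := SimpContFract.determinant (s := SimpContFract.of α) (n := n)
    (not_terminatedAt_of_irrational hα n)
  have e : ((SimpContFract.of α : SimpContFract ℝ) : GenContFract ℝ) = GenContFract.of α := rfl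
  rw [e] at hdet
  have h1 : (GenContFract.of α).nums n = a := by
    rw [GenContFract.num_eq_conts_a, GenContFract.nth_cont_eq_succ_nth_contAux, h]
  have h2 : (GenContFract.of α).dens n = b := by
    rw [GenContFract.den_eq_conts_b, GenContFract.nth_cont_eq_succ_nth_contAux, h]
  have h3 : (GenContFract.of α).nums (n + 1) = a' := by
    rw [GenContFract.num_eq_conts_a, GenContFract.nth_cont_eq_succ_nth_contAux, h']
  have h4 : (GenContFract.of α).dens (n + 1) = b' := by
    rw [GenContFract.den_eq_conts_b, GenContFract.nth_cont_eq_succ_nth_contAux, h']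
  refine ⟨a, b, h1, h2, ?_⟩
  rw [h1, h2, h3, h4] at hdet
  have hdet' : a * b' - b * a' = (-1) ^ (n + 1) := by exact_mod_cast hdet
  have hsq : ((-1 : ℤ) ^ (n + 1)) * (-1) ^ (n + 1) = 1 := by
    rw [← mul_pow]; norm_num
  -- The determinant identity times its own sign is a Bézout relation.
  refine ⟨(-1) ^ (n + 1) * b', -((-1) ^ (n + 1) * a'), ?_⟩
  linear_combination (-1) ^ (n + 1) * hdet' + hsq

/-- The convergent preceding a partial denominator `q` has error at most `1/(q b²)`, so `c ≤ 1/q`.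
-/
theorem BadlyApproximable.boundedPartialQuotients {α : ℝ} (hα : Irrational α)
    (h : BadlyApproximable α) : BoundedPartialQuotients α := by
  obtain ⟨c, hc, h⟩ := h
  refine ⟨max (GenContFract.of α).h (1 / c), le_max_left _ _, fun i q hq => le_max_of_le_right ?_⟩
  obtain ⟨a, b, ha, hb, -⟩ := exists_coprime_nums_dens hα i
  have hle := GenContFract.abs_sub_convergents_le' hq
  have hq1 : 1 ≤ q := GenContFract.of_one_le_get?_partDen hq
  have hb1 := one_le_dens α i
  rw [GenContFract.conv_eq_num_div_den, ha, hb] at hle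
  rw [hb] at hb1
  have hb0 : 1 ≤ b := by exact_mod_cast hb1
  obtain ⟨n, rfl⟩ := Int.eq_ofNat_of_zero_le (by omega : 0 ≤ b)
  have hn := h n (by omega) a
  push_cast at hb1 hle
  have hn0 : (0 : ℝ) < n := by linarith
  have e : (n : ℝ) * |n * α - a| = n ^ 2 * |α - a / n| :=
    mul_abs_mul_sub_eq hn0 α a
  rw [e] at hn
  have h2 : c ≤ 1 / q := by
    calc c ≤ (n : ℝ) ^ 2 * |α - a / n| := hn
      _ ≤ (n : ℝ) ^ 2 * (1 / (q * n * n)) := by gcongr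
      _ = 1 / q := by field_simp
  rw [le_div_iff₀ (by linarith)] at h2
  rw [le_div_iff₀ hc]
  linarith

/-- The error is exactly `1/(b(ξb + b'))`, where `b' ≤ b` is the previous denominator and the
complete quotient `ξ` is at most `B + 1`. -/
theorem le_abs_sub_convs {α B : ℝ} (hα : Irrational α)
    (hB : ∀ (i : ℕ) (q : ℝ), (GenContFract.of α).partDens.get? i = some q → q ≤ B) (n : ℕ) :
    1 / ((B + 2) * (GenContFract.of α).dens n ^ 2) ≤ |α - (GenContFract.of α).convs n| := by
  have hnt := not_terminatedAt_of_irrational hα n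
  rw [GenContFract.of_terminatedAt_n_iff_succ_nth_intFractPair_stream_eq_none] at hnt
  obtain ⟨ifp', hifp'⟩ := Option.ne_none_iff_exists'.1 hnt
  obtain ⟨ifp, h, hfr, he⟩ := GenContFract.IntFractPair.succ_nth_stream_eq_some_iff.1 hifp'
  have hs := GenContFract.get?_of_eq_some_of_get?_intFractPair_stream_fr_ne_zero h hfr
  have hq := hB n _ (GenContFract.partDen_eq_s_b hs)
  have hsub := GenContFract.sub_convs_eq h
  simp only [hfr, if_false] at hsub
  rw [hsub]
  have hd : (GenContFract.of α).dens n = ((GenContFract.of α).contsAux (n + 1)).b := by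
    rw [GenContFract.den_eq_conts_b, GenContFract.nth_cont_eq_succ_nth_contAux]
  have hb1 := one_le_dens α n
  rw [hd] at hb1 ⊢
  set b := ((GenContFract.of α).contsAux (n + 1)).b
  set b' := ((GenContFract.of α).contsAux n).b with hb'
  have hb'0 : 0 ≤ b' := GenContFract.zero_le_of_contsAux_b
  have hb'b : b' ≤ b := by
    rcases n with _ | m
    · simp only [b', GenContFract.contsAux]
      linarith
    · rw [← hd, hb', ← GenContFract.nth_cont_eq_succ_nth_contAux, ← GenContFract.den_eq_conts_b]
      exact GenContFract.of_den_mono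
  have hfr0 : 0 < ifp.fr :=
    lt_of_le_of_ne (GenContFract.IntFractPair.nth_stream_fr_nonneg h) (Ne.symm hfr)
  have hinv : ifp.fr⁻¹ ≤ B + 1 := by
    have : (GenContFract.IntFractPair.of ifp.fr⁻¹).b = ⌊ifp.fr⁻¹⌋ := rfl
    rw [this] at hq
    have := Int.lt_floor_add_one ifp.fr⁻¹
    dsimp only at hq
    linarith
  have hinv0 : 0 < ifp.fr⁻¹ := inv_pos.2 hfr0
  rw [abs_div, abs_pow, abs_neg, abs_one, one_pow,
    abs_of_pos (by positivity : 0 < b * (ifp.fr⁻¹ * b + b'))]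
  apply one_div_le_one_div_of_le (by positivity)
  nlinarith [mul_le_mul_of_nonneg_right hinv (by positivity : 0 ≤ b * b),
    mul_le_mul_of_nonneg_left hb'b (by positivity : 0 ≤ b)]

/-- Reducing the fraction `p/n` only improves the approximation. If it is too good, Legendre makes
it a convergent, against `le_abs_sub_convs`; coprimality identifies the two denominators. -/
theorem BoundedPartialQuotients.badlyApproximable {α : ℝ} (hα : Irrational α)
    (h : BoundedPartialQuotients α) : BadlyApproximable α := by
  obtain ⟨B, -, hB⟩ := h
  have hB1 : 1 ≤ B := by
    obtain ⟨gp, hgp⟩ := Option.ne_none_iff_exists'.1 (not_terminatedAt_of_irrational hα 0)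
    have hp := GenContFract.partDen_eq_s_b hgp
    exact (GenContFract.of_one_le_get?_partDen hp).trans (hB 0 _ hp)
  refine ⟨1 / (B + 2), by positivity, fun n hn p => ?_⟩
  by_contra! hlt
  have hn0 : (0 : ℝ) < n := by exact_mod_cast hn
  set q : ℚ := (p : ℚ) / (n : ℚ) with hqdef
  have hqr : (q : ℝ) = p / n := by simp [hqdef]
  have hden : q.den ≤ n := by
    have h1 : (q.den : ℤ) ∣ (n : ℤ) := by
      have := Rat.den_dvd p (n : ℤ)
      rwa [Rat.divInt_eq_div, Int.cast_natCast, ← hqdef] at this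
    exact Nat.le_of_dvd (by omega) (by exact_mod_cast h1)
  have e : (n : ℝ) * |n * α - p| = n ^ 2 * |α - q| := by
    rw [hqr, mul_abs_mul_sub_eq hn0]
  rw [e] at hlt
  have hd0 : (0 : ℝ) < q.den := by exact_mod_cast q.pos
  have hlt' : (q.den : ℝ) ^ 2 * |α - q| < 1 / (B + 2) := by
    refine lt_of_le_of_lt ?_ hlt
    gcongr
  have hleg : |α - q| < 1 / (2 * (q.den : ℝ) ^ 2) := by
    rw [lt_div_iff₀ (by positivity)] at hlt' ⊢
    have : 0 ≤ (q.den : ℝ) ^ 2 * |α - q| := by positivity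
    nlinarith
  obtain ⟨k, hk⟩ := Real.exists_convs_eq_rat hleg
  obtain ⟨a, b, ha, hb, hab⟩ := exists_coprime_nums_dens hα k
  have hlow := le_abs_sub_convs hα hB k
  have hb1 := one_le_dens α k
  rw [hk, hb] at hlow
  rw [hb] at hb1
  have hbz : 0 < b := by exact_mod_cast (by linarith : (0 : ℝ) < b)
  have hqab : q = (a : ℚ) / b := by
    rw [GenContFract.conv_eq_num_div_den, ha, hb] at hk
    exact_mod_cast hk.symm
  have hqden : (q.den : ℤ) = b := by
    rw [hqab]
    exact Rat.den_div_eq_of_coprime hbz (Int.isCoprime_iff_nat_coprime.1 hab)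
  have hqden' : (q.den : ℝ) = b := by exact_mod_cast hqden
  rw [hqden'] at hlt'
  have : (b : ℝ) ^ 2 * (1 / ((B + 2) * b ^ 2)) = 1 / (B + 2) := by field_simp
  have := mul_le_mul_of_nonneg_left hlow (by positivity : (0 : ℝ) ≤ (b : ℝ) ^ 2)
  linarith

theorem badlyApproximable_iff_boundedPartialQuotients {α : ℝ} (hα : Irrational α) :
    BadlyApproximable α ↔ BoundedPartialQuotients α :=
  ⟨fun h => h.boundedPartialQuotients hα, fun h => h.badlyApproximable hα⟩

theorem exists_int_mul_sub_eq {p : ℤ} {d : ℕ} (hd : 0 < d) (hpd : IsCoprime p (d : ℤ)) (t : ℤ) :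
    ∃ j : ℕ, j < d ∧ ∃ m : ℤ, (j : ℤ) * p - m * d = t := by
  obtain ⟨u, v, huv⟩ := hpd
  have hd' : (0 : ℤ) < d := by exact_mod_cast hd
  have h0 := Int.emod_nonneg (u * t) hd'.ne'
  have h1 := Int.emod_lt_of_pos (u * t) hd'
  have h2 := Int.emod_add_mul_ediv (u * t) d
  refine ⟨((u * t) % d).toNat, by omega, -(u * t / d * p) - v * t, ?_⟩
  rw [Int.toNat_of_nonneg h0]
  linear_combination p * h2 + t * huv

/-- If `α` is badly approximable, every arc of length `D / N` contains one of any `N` consecutive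
points of an orbit of the rotation by `α`. -/
theorem BadlyApproximableWith.exists_mem_arc {α c : ℝ} (hc : 0 < c)
    (h : BadlyApproximableWith α c) {N : ℕ} (hN : 1 ≤ N) (x y : ℝ) {ε : ℝ}
    (hε : 4 / c / N ≤ ε) :
    ∃ j : ℕ, j < N ∧ ∃ m : ℤ, y < x + j * α - m ∧ x + j * α - m < y + ε := by
  -- Dirichlet's approximation; bad approximability forces its denominator to be at least `cN`.
  obtain ⟨q, hq, hqN⟩ := Real.exists_rat_abs_sub_le_and_den_le α hN
  have hd0 : (0 : ℝ) < q.den := by exact_mod_cast q.pos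
  have hN0 : (0 : ℝ) < N := by exact_mod_cast hN
  have hqr : (q : ℝ) = q.num / q.den := by exact_mod_cast (Rat.num_div_den q).symm
  have hcd : c * N ≤ q.den := by
    have h1 := h q.den q.pos q.num
    have e : (q.den : ℝ) * |q.den * α - q.num| = q.den ^ 2 * |α - q| := by
      rw [hqr, mul_abs_mul_sub_eq hd0]
    rw [e] at h1
    have h2 : c ≤ q.den / (N + 1) := by
      calc c ≤ (q.den : ℝ) ^ 2 * (1 / ((N + 1) * q.den)) := h1.trans (by gcongr)
        _ = q.den / (N + 1) := by field_simp
    rw [le_div_iff₀ (by positivity)] at h2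
    nlinarith
  have hεd : 4 / q.den ≤ ε := by
    refine le_trans ?_ hε
    rw [div_div]
    gcongr
  -- The points `j * q` with `j < q.den` run through all multiples of `1/q.den` modulo 1, and `jα`
  -- is off by less than `1/q.den`. The `+ 2` keeps the target above `y` despite floor and error.
  set t : ℤ := ⌊(q.den : ℝ) * (y - x)⌋ + 2 with ht
  have ht1 := Int.floor_le ((q.den : ℝ) * (y - x))
  have ht2 := Int.lt_floor_add_one ((q.den : ℝ) * (y - x))
  have htr : (t : ℝ) = ⌊(q.den : ℝ) * (y - x)⌋ + 2 := by simp [ht]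
  obtain ⟨j, hj, m, hm⟩ := exists_int_mul_sub_eq q.pos (Rat.isCoprime_num_den q) t
  have hm' : (j : ℝ) * q.num - m * q.den = t := by exact_mod_cast hm
  have hjd : (j : ℝ) < q.den := by exact_mod_cast hj
  have herr : |(j : ℝ) * (α - q)| * q.den < 1 := by
    rw [abs_mul, abs_of_nonneg (Nat.cast_nonneg j)]
    calc (j : ℝ) * |α - q| * q.den ≤ j * (1 / ((N + 1) * q.den)) * q.den := by gcongr
      _ = j / (N + 1) := by field_simp
      _ < 1 := by
        rw [div_lt_one (by positivity)]
        have : (q.den : ℝ) ≤ N := by exact_mod_cast hqN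
        linarith
  have e : (x + j * α - m) * q.den = x * q.den + t + j * (α - q) * q.den := by
    rw [← hm', hqr]
    field_simp
    ring
  have herr' : |(j : ℝ) * (α - q) * q.den| < 1 := by rwa [abs_mul, abs_of_pos hd0]
  obtain ⟨he1, he2⟩ := abs_lt.1 herr'
  refine ⟨j, hj.trans_le hqN, m, ?_, ?_⟩
  · refine lt_of_mul_lt_mul_right ?_ hd0.le
    rw [e]
    linarith
  · refine lt_of_mul_lt_mul_right ?_ hd0.le
    rw [e]
    have : 4 ≤ ε * q.den := by rwa [div_le_iff₀ hd0] at hεd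
    linarith

end DiophantineApproximation

end AbSq

namespace AbSq

/-! ### Factors, powers and recurrence in arbitrary words -/

section Blocks

variable {A : Type*}

@[simp]
theorem length_block (w : ℕ → A) (i n : ℕ) : (block w i n).length = n := by
  simp [block]

theorem isFactor_block (w : ℕ → A) (i n : ℕ) : IsFactor (block w i n) w := ⟨i, n, rfl⟩

theorem block_succ (w : ℕ → A) (i n : ℕ) : block w i (n + 1) = block w i n ++ [w (i + n)] := by
  simp [block, List.range_succ]

theorem block_add (w : ℕ → A) (i m n : ℕ) :
    block w i (m + n) = block w i m ++ block w (i + m) n := by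
  induction n with
  | zero => simp [block]
  | succ n ih => rw [← add_assoc, block_succ, ih, block_succ, List.append_assoc, add_assoc]

theorem block_eq_block_iff {w : ℕ → A} {i j n : ℕ} :
    block w i n = block w j n ↔ ∀ l < n, w (i + l) = w (j + l) := by
  simp [block]

theorem infix_block_iff {w : ℕ → A} {i m : ℕ} {u : List A} :
    u <:+: block w i m ↔ ∃ j n, j + n ≤ m ∧ u = block w (i + j) n := by
  constructor
  · rintro ⟨p, q, h⟩
    have hl : p.length + u.length + q.length = m := by
      simpa [add_assoc] using congrArg List.length h
    refine ⟨p.length, u.length, by omega, ?_⟩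
    rw [← hl, block_add, block_add] at h
    exact (List.append_inj (List.append_inj h (by simp)).1 (by simp)).2
  · rintro ⟨j, n, h, rfl⟩
    obtain ⟨r, rfl⟩ := Nat.exists_eq_add_of_le h
    exact ⟨block w i j, block w (i + (j + n)) r, by rw [block_add, block_add]⟩

theorem block_eq_flatten_iff {w : ℕ → A} {i k : ℕ} {u : List A} :
    block w i (k * u.length) = (List.replicate k u).flatten ↔
      ∀ r < k, block w (i + r * u.length) u.length = u := by
  induction k with
  | zero => simp [block]
  | succ k ih =>
    rw [Nat.add_mul, one_mul, block_add, List.replicate_succ', List.flatten_append]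
    simp only [List.flatten_cons, List.flatten_nil, List.append_nil]
    rw [Nat.forall_lt_succ_right, ← ih]
    constructor
    · intro h
      exact List.append_inj h (by simp)
    · rintro ⟨h1, h2⟩
      rw [h1, h2]

/-- The word `w` has period `n` on the positions `i, …, i + M - 1`. -/
def PeriodicOn (w : ℕ → A) (i n M : ℕ) : Prop :=
  ∀ j, j + n < M → w (i + j + n) = w (i + j)

theorem PeriodicOn.apply_mod {w : ℕ → A} {i n M : ℕ} (h : PeriodicOn w i n M) (j : ℕ)
    (hj : j < M) : w (i + j) = w (i + j % n) := by
  induction j using Nat.strong_induction_on with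
  | _ j ih =>
    rcases Nat.lt_or_ge j n with hlt | hge
    · rw [Nat.mod_eq_of_lt hlt]
    · rcases Nat.eq_zero_or_pos n with rfl | hn
      · simp
      obtain ⟨l, rfl⟩ := Nat.exists_eq_add_of_le' hge
      rw [← add_assoc, h l hj, ih l (by omega) (by omega), Nat.add_mod_right]

theorem isPower_block_iff {w : ℕ → A} {i k M : ℕ} :
    IsPower k (block w i M) ↔ ∃ n, 1 ≤ n ∧ M = k * n ∧ PeriodicOn w i n M := by
  constructor
  · rintro ⟨u, hu, h⟩
    have hM : M = k * u.length := by simpa using congrArg List.length h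
    have hn : 1 ≤ u.length := List.length_pos_iff.2 hu
    refine ⟨u.length, hn, hM, fun j hj => ?_⟩
    rw [hM, block_eq_flatten_iff] at h
    set n := u.length
    have hr : j / n + 1 < k := by
      have h1 : (j / n + 1) * n < k * n := by
        have := Nat.div_add_mod j n
        rw [hM] at hj
        linarith [Nat.zero_le (j % n)]
      exact lt_of_mul_lt_mul_right h1 (Nat.zero_le _)
    have h1 := h (j / n) (by omega)
    have h2 := h (j / n + 1) hr
    have h3 := block_eq_block_iff.1 (h2.trans h1.symm) (j % n) (Nat.mod_lt j hn)
    have e : j / n * n + j % n = j := Nat.div_add_mod' j n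
    rw [show i + (j / n + 1) * n + j % n = i + (j / n * n + j % n) + n by ring,
      show i + j / n * n + j % n = i + (j / n * n + j % n) by ring, e] at h3
    exact h3
  · rintro ⟨n, hn, rfl, h⟩
    refine ⟨block w i n, by simp [← List.length_pos_iff]; omega, ?_⟩
    have := block_eq_flatten_iff (w := w) (i := i) (k := k) (u := block w i n)
    rw [length_block] at this
    refine this.2 fun r hr => block_eq_block_iff.2 fun l hl => ?_
    have hlt : r * n + l < k * n := by nlinarith
    rw [add_assoc, h.apply_mod _ hlt, Nat.mul_add_mod', Nat.mod_eq_of_lt hl]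

theorem powerFree_iff {w : ℕ → A} {k : ℕ} :
    PowerFree k w ↔ ∀ i n, 1 ≤ n → ¬ PeriodicOn w i n (k * n) := by
  constructor
  · intro h i n hn hp
    exact h _ (isFactor_block w i (k * n)) (isPower_block_iff.2 ⟨n, hn, rfl, hp⟩)
  · rintro h v ⟨i, M, rfl⟩ hv
    obtain ⟨n, hn, rfl, hp⟩ := isPower_block_iff.1 hv
    exact h i n hn hp

theorem FactorsContain.mono {w : ℕ → A} {m m' n : ℕ} (h : FactorsContain w m n) (hm : m ≤ m') :
    FactorsContain w m' n := by
  rintro v ⟨i, l, rfl⟩ hl u hu hn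
  rw [length_block] at hl
  obtain ⟨r, rfl⟩ := Nat.exists_eq_add_of_le hm
  refine (h _ (isFactor_block w i m) (by simp) u hu hn).trans ?_
  exact infix_block_iff.2 ⟨0, m, by omega, rfl⟩

theorem recurrenceIndex_le_iff {w : ℕ → A} {m n : ℕ} :
    recurrenceIndex w n ≤ m ↔ FactorsContain w m n := by
  constructor
  · intro h
    have hne : ((fun m : ℕ => (m : ℕ∞)) '' {m | FactorsContain w m n}).Nonempty := by
      by_contra hne
      rw [Set.not_nonempty_iff_eq_empty] at hne
      rw [recurrenceIndex, hne, sInf_empty] at h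
      exact absurd h (by simp)
    obtain ⟨m', hm', he⟩ := csInf_mem hne
    have h' : ((m' : ℕ) : ℕ∞) ≤ m := by
      dsimp only at he
      rw [he]
      exact h
    exact FactorsContain.mono hm' (by exact_mod_cast h')
  · intro h
    exact sInf_le ⟨m, h, rfl⟩

theorem linearlyRecurrent_iff {w : ℕ → A} :
    LinearlyRecurrent w ↔ ∃ K : ℕ, ∀ n, 1 ≤ n → FactorsContain w (K * n) n := by
  constructor
  · rintro ⟨-, K, hK⟩
    exact ⟨K, fun n hn => recurrenceIndex_le_iff.1 (by exact_mod_cast hK n hn)⟩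
  · rintro ⟨K, hK⟩
    have h : ∀ n, 1 ≤ n → recurrenceIndex w n ≤ (K : ℕ∞) * (n : ℕ∞) := fun n hn => by
      exact_mod_cast recurrenceIndex_le_iff.2 (hK n hn)
    refine ⟨fun n => ?_, K, h⟩
    rcases Nat.eq_zero_or_pos n with rfl | hn
    · have : recurrenceIndex w 0 ≤ (0 : ℕ) := by
        refine recurrenceIndex_le_iff.2 fun v _ _ u _ hu => ?_
        rw [List.length_eq_zero_iff.1 hu]
        exact List.nil_infix
      exact ne_top_of_le_ne_top (by simp) this
    · refine ne_top_of_le_ne_top ?_ (h n hn)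
      exact_mod_cast ENat.natCast_ne_top (K * n)

variable [DecidableEq A]

/-- A factor of a word of period `n` is determined by its length and its starting position modulo
`n`. -/
theorem abelianSquareCountLength_le {w : ℕ → A} {i n M : ℕ} (hn : 1 ≤ n)
    (h : PeriodicOn w i n M) (m : ℕ) : abelianSquareCountLength (block w i M) m ≤ n := by
  rcases Nat.eq_zero_or_pos m with rfl | hm
  · have : abelianSquareFactors (block w i M) 0 = ∅ := by
      ext u
      simp only [abelianSquareFactors, Set.mem_ofPred_eq, Set.mem_empty_iff_false, iff_false]
      rintro ⟨-, hu, hl⟩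
      exact hu.1 (List.length_eq_zero_iff.1 hl)
    simp [abelianSquareCountLength, this]
  have hsub : abelianSquareFactors (block w i M) m ⊆
      ((Finset.range n).image fun j => (List.range m).map fun l => w (i + (j + l) % n) :
        Finset (List A)) := by
    rintro u ⟨hu, -, hl⟩
    obtain ⟨j, m', hj, rfl⟩ := infix_block_iff.1 hu
    rw [length_block] at hl
    subst hl
    simp only [Finset.coe_image, Finset.coe_range, Set.mem_image, Set.mem_Iio]
    refine ⟨j % n, Nat.mod_lt _ hn, ?_⟩
    rw [block]
    refine List.map_congr_left fun l hl => ?_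
    rw [List.mem_range] at hl
    rw [add_assoc i j l, h.apply_mod (j + l) (by omega), Nat.mod_add_mod]
  calc abelianSquareCountLength (block w i M) m
      ≤ ((Finset.range n).image fun j =>
        (List.range m).map fun l => w (i + (j + l) % n)).card := by
        rw [← Set.ncard_coe_finset]
        exact Set.ncard_le_ncard hsub (Finset.finite_toSet _)
    _ ≤ n := Finset.card_image_le.trans (by simp)

/-- A `k`-power of period `n` contains at most `(kn + 1)n` abelian squares, fewer than `C(kn)²` once
`k > 2/C`. Taking `k ≥ N` makes the power long enough for richness to apply. -/
theorem UniformlyAbelianSquareRich.boundedExponent {w : ℕ → A}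
    (h : UniformlyAbelianSquareRich w) : BoundedExponent w := by
  obtain ⟨C, hC, N, h⟩ := h
  obtain ⟨k₀, hk₀⟩ := exists_nat_gt (2 / C)
  set k := max k₀ (max N 2) with hk
  have hkN : N ≤ k := (le_max_left N 2).trans (le_max_right _ _)
  have hk2 : 2 ≤ k := (le_max_right N 2).trans (le_max_right _ _)
  have hkC : 2 / C < k := hk₀.trans_le (by exact_mod_cast le_max_left _ _)
  refine ⟨k, hk2, powerFree_iff.2 fun i n hn hp => ?_⟩
  have hkn : 1 ≤ k * n := Nat.one_le_iff_ne_zero.2 (by positivity)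
  have h1 := h _ (isFactor_block w i (k * n)) (by rw [length_block]; nlinarith)
  have h2 : abelianSquareCount (block w i (k * n)) ≤ (k * n + 1) * n := by
    rw [abelianSquareCount]
    refine (Finset.sum_le_card_nsmul _ _ n fun m _ => abelianSquareCountLength_le hn hp m).trans ?_
    simp
  have h3 : (abelianSquareCount (block w i (k * n)) : ℝ) ≤ 2 * (k * n) * n := by
    have : abelianSquareCount (block w i (k * n)) ≤ 2 * (k * n) * n :=
      h2.trans (Nat.mul_le_mul_right n (by omega))
    exact_mod_cast this
  rw [length_block] at h1
  push_cast at h1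
  have hn0 : (0 : ℝ) < n := by exact_mod_cast hn
  have hk0 : (0 : ℝ) < k := by exact_mod_cast (by omega : 0 < k)
  rw [div_lt_iff₀ hC] at hkC
  have h4 : 0 < (k : ℝ) * n ^ 2 := by positivity
  nlinarith [mul_lt_mul_of_pos_right hkC h4]

end Blocks

end AbSq

namespace AbSq

/-! ### Sturmian words as increments of a rounding function -/

section Coding

/-- The properties shared by the floor and the ceiling functions. -/
structure IsRounding (F : ℝ → ℤ) : Prop where
  mono : Monotone F
  map_add_int : ∀ (x : ℝ) (m : ℤ), F (x + m) = F x + m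
  -- Strict inequalities here and weak ones in `exists_int` leave the value at integers free, where
  -- floor and ceiling jump differently.
  lt_of_lt : ∀ {x y : ℝ} {m : ℤ}, x < m → m < y → F x < F y
  exists_int : ∀ {x y : ℝ}, F x < F y → ∃ m : ℤ, x ≤ m ∧ m ≤ y
  abs_sub_le : ∀ x : ℝ, |(F x : ℝ) - x| ≤ 1

theorem isRounding_floor : IsRounding (fun x : ℝ => ⌊x⌋) where
  mono := Int.floor_mono
  map_add_int x m := Int.floor_add_intCast x m
  lt_of_lt {x y m} hx hy := (Int.floor_lt.2 hx).trans_le (Int.le_floor.2 hy.le)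
  exists_int {x y} h := by
    refine ⟨⌊x⌋ + 1, by push_cast; exact (Int.lt_floor_add_one x).le, ?_⟩
    exact Int.le_floor.1 h
  abs_sub_le x := by
    rw [abs_le]
    constructor <;> linarith [Int.floor_le x, Int.lt_floor_add_one x]

theorem isRounding_ceil : IsRounding (fun x : ℝ => ⌈x⌉) where
  mono := Int.ceil_mono
  map_add_int x m := Int.ceil_add_intCast x m
  lt_of_lt {x y m} hx hy := (Int.ceil_le.2 hx.le).trans_lt (Int.lt_ceil.2 hy)
  exists_int {x y} h := ⟨⌈x⌉, Int.le_ceil x, (Int.lt_ceil.1 h).le⟩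
  abs_sub_le x := by
    rw [abs_le]
    constructor <;> linarith [Int.le_ceil x, Int.ceil_lt_add_one x]

/-- The sign condition records on which side of `x` the integer lies, so that two such events can be
compared with error `|d|` instead of `2|d|`. -/
theorem IsRounding.exists_int_of_ne {F : ℝ → ℤ} (hF : IsRounding F) {x d : ℝ}
    (h : F (x + d) ≠ F x) : ∃ m : ℤ, |x - m| ≤ |d| ∧ 0 ≤ (m - x) * d := by
  rcases lt_or_gt_of_ne h with h | h
  · obtain ⟨m, h1, h2⟩ := hF.exists_int h
    refine ⟨m, ?_, mul_nonneg_of_nonpos_of_nonpos (by linarith) (by linarith)⟩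
    rw [abs_of_nonneg (by linarith), abs_of_nonpos (by linarith)]
    linarith
  · obtain ⟨m, h1, h2⟩ := hF.exists_int h
    refine ⟨m, ?_, mul_nonneg (by linarith) (by linarith)⟩
    rw [abs_of_nonpos (by linarith), abs_of_nonneg (by linarith)]
    linarith

/-- The orbit of `ρ` under the translation by `α`. -/
def orbit (α ρ : ℝ) (n : ℕ) : ℝ := ρ + n * α

theorem orbit_add (α ρ : ℝ) (i n : ℕ) : orbit α ρ (i + n) = orbit α ρ i + n * α := by
  simp only [orbit]
  push_cast
  ring

/-- The word `s` codes the increments of `F` along the orbit of `ρ`. -/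
def IsCoding (s : ℕ → Letter) (α ρ : ℝ) (F : ℝ → ℤ) : Prop :=
  ∀ n, F (orbit α ρ (n + 1)) = F (orbit α ρ n) + if s n = Letter.a then 1 else 0

theorem isCoding_sturmianLower {α : ℝ} (h0 : 0 < α) (h1 : α < 1) (ρ : ℝ) :
    IsCoding (sturmianLower α ρ) α ρ (fun x => ⌊x⌋) := by
  intro n
  rw [orbit_add, Nat.cast_one, one_mul]
  set x := orbit α ρ n with hx
  have hx' : ρ + n * α = x := rfl
  have hf := Int.floor_add_fract x
  have hf0 := Int.fract_nonneg x
  have hf1 := Int.fract_lt_one x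
  simp only [sturmianLower, hx', Set.mem_Ico, hf0, true_and]
  split_ifs with h h'
  · exact absurd h' (by simp)
  · rw [add_zero, Int.floor_eq_iff]
    constructor <;> linarith
  · rw [Int.floor_eq_iff]
    push_cast
    constructor <;> linarith
  · simp_all

theorem isCoding_sturmianUpper {α : ℝ} (h0 : 0 < α) (h1 : α < 1) (ρ : ℝ) :
    IsCoding (sturmianUpper α ρ) α ρ (fun x => ⌈x⌉) := by
  intro n
  rw [orbit_add, Nat.cast_one, one_mul]
  set x := orbit α ρ n with hx
  have hx' : ρ + n * α = x := rfl
  have hf := Int.floor_add_fract x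
  have hf0 := Int.fract_nonneg x
  have hf1 := Int.fract_lt_one x
  have hc : 0 < Int.fract x → ⌈x⌉ = ⌊x⌋ + 1 := fun hpos => by
    rw [Int.ceil_eq_iff]
    push_cast
    constructor <;> linarith
  simp only [sturmianUpper, hx', Set.mem_Ioc]
  split_ifs with h h'
  · exact absurd h' (by simp)
  · rw [hc h.1, add_zero, Int.ceil_eq_iff]
    push_cast
    constructor <;> linarith
  -- At an integer point the letter is `a`, and the ceiling does jump on the next step.
  · rcases hf0.eq_or_lt with hz | hpos
    · have : ⌈x⌉ = ⌊x⌋ := by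
        rw [Int.ceil_eq_iff]
        constructor <;> linarith
      rw [this, Int.ceil_eq_iff]
      push_cast
      constructor <;> linarith
    · have : 1 - α < Int.fract x := by
        by_contra! hle
        exact h ⟨hpos, hle⟩
      rw [hc hpos, Int.ceil_eq_iff]
      push_cast
      constructor <;> linarith
  · simp_all

theorem IsSturmianOfAngle.exists_isCoding {s : ℕ → Letter} {α : ℝ} (hs : IsSturmianOfAngle s α) :
    ∃ ρ F, IsRounding F ∧ IsCoding s α ρ F := by
  obtain ⟨hα, ⟨h0, h1⟩, ρ, -, h⟩ := hs
  have h0' : 0 < α := lt_of_le_of_ne h0 fun h => hα ⟨0, by simp [← h]⟩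
  rcases h with rfl | rfl
  · exact ⟨ρ, _, isRounding_floor, isCoding_sturmianLower h0' h1 ρ⟩
  · exact ⟨ρ, _, isRounding_ceil, isCoding_sturmianUpper h0' h1 ρ⟩

variable {s : ℕ → Letter} {α ρ : ℝ} {F : ℝ → ℤ}

theorem IsCoding.add_count (hs : IsCoding s α ρ F) (i n : ℕ) :
    F (orbit α ρ (i + n)) = F (orbit α ρ i) + (block s i n).count Letter.a := by
  induction n with
  | zero => simp [block]
  | succ n ih =>
    rw [← add_assoc, hs, ih, block_succ, List.count_append, List.count_singleton]
    by_cases h : s (i + n) = Letter.a <;> simp [h, add_assoc]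

theorem IsCoding.apply_eq_iff (hs : IsCoding s α ρ F) (i j : ℕ) :
    s i = s j ↔ F (orbit α ρ (i + 1)) - F (orbit α ρ i) =
      F (orbit α ρ (j + 1)) - F (orbit α ρ j) := by
  rw [hs, hs]
  rcases hi : s i <;> rcases hj : s j <;> simp

/-- Two blocks agree if and only if `F` has the same increments along both. -/
theorem IsCoding.block_eq_iff (hs : IsCoding s α ρ F) (i j n : ℕ) :
    block s i n = block s j n ↔ ∀ l ≤ n, F (orbit α ρ (i + l)) - F (orbit α ρ i) =
      F (orbit α ρ (j + l)) - F (orbit α ρ j) := by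
  constructor
  · intro h l hl
    have h' : block s i l = block s j l :=
      block_eq_block_iff.2 fun r hr => block_eq_block_iff.1 h r (hr.trans_le hl)
    rw [hs.add_count, hs.add_count, h']
    ring
  · intro h
    refine block_eq_block_iff.2 fun l hl => (hs.apply_eq_iff _ _).2 ?_
    have h1 := h l hl.le
    have h2 := h (l + 1) hl
    rw [← add_assoc, ← add_assoc] at h2
    linarith

/-- The increment over `n` steps changes from `j` to `j + 1` by the difference of the two letters
`n` apart. `M` letters involve `M + 1` orbit points, hence `≤` where `PeriodicOn` has `<`. -/
theorem IsCoding.periodicOn_iff (hs : IsCoding s α ρ F) (i n M : ℕ) :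
    PeriodicOn s i n M ↔ ∀ j, j + n ≤ M → F (orbit α ρ (i + j + n)) - F (orbit α ρ (i + j)) =
      F (orbit α ρ (i + n)) - F (orbit α ρ i) := by
  constructor
  · intro h j
    induction j with
    | zero => simp
    | succ j ih =>
      intro hj
      have h1 := ih (by omega)
      have h2 := (hs.apply_eq_iff _ _).1 (h j (by omega))
      rw [show i + (j + 1) + n = i + j + n + 1 by ring, ← add_assoc i j 1]
      linarith
  · intro h j hj
    have h1 := h j hj.le
    have h2 := h (j + 1) (by omega)
    rw [show i + (j + 1) + n = i + j + n + 1 by ring, ← add_assoc i j 1] at h2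
    refine (hs.apply_eq_iff _ _).2 ?_
    linarith

end Coding

end AbSq

namespace AbSq

/-! ### Bounded exponent, bad approximability and linear recurrence -/

section Recurrence

variable {s : ℕ → Letter} {α ρ : ℝ} {F : ℝ → ℤ}

theorem natCast_mul_sub_ne_zero (hα : Irrational α) {n : ℕ} (hn : 1 ≤ n) (p : ℤ) :
    (n : ℝ) * α - p ≠ 0 := by
  have := (hα.natCast_mul (by omega : n ≠ 0)).sub_intCast p
  exact this.ne_zero

theorem IsRounding.add_eq_iff (hF : IsRounding F) (x y : ℝ) (p : ℤ) :
    F (x + y) - F x = p ↔ F (x + (y - p)) = F x := by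
  have := hF.map_add_int (x + (y - p)) p
  rw [show x + (y - p) + (p : ℝ) = x + y by ring] at this
  omega

/-- In a high power of period `n`, no orbit point is carried across an integer by `δ = nα - p`. But
`|δ| ≥ c/n`, so some orbit point in the stretch lies in the arc of length `|δ|` beside an integer.
-/
theorem IsCoding.boundedExponent (hF : IsRounding F) (hs : IsCoding s α ρ F)
    (h : BadlyApproximable α) : BoundedExponent s := by
  obtain ⟨c, hc, h⟩ := h
  obtain ⟨k, hk⟩ := exists_nat_ge (4 / c / c)
  refine ⟨k + 2, by omega, powerFree_iff.2 fun i n hn hp => ?_⟩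
  have hn0 : (0 : ℝ) < n := by exact_mod_cast hn
  rw [hs.periodicOn_iff] at hp
  obtain ⟨p, hpe⟩ : ∃ p, F (orbit α ρ (i + n)) - F (orbit α ρ i) = p := ⟨_, rfl⟩
  rw [hpe] at hp
  have hδ := h.div_le hn p
  set δ := n * α - p with hδd
  have hp' : ∀ j < (k + 1) * n, F (orbit α ρ i + j * α + δ) = F (orbit α ρ i + j * α) := by
    intro j hj
    have := hp j (by linarith)
    rw [orbit_add, hF.add_eq_iff, orbit_add] at this
    exact this
  have hN : 1 ≤ (k + 1) * n := Nat.mul_pos (by omega) hn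
  have hε : 4 / c / (((k + 1) * n : ℕ) : ℝ) ≤ |δ| := by
    refine le_trans ?_ hδ
    push_cast
    rw [div_le_div_iff₀ (by positivity) hn0]
    rw [div_le_iff₀ hc] at hk
    nlinarith
  rcases le_or_gt 0 δ with h0 | h0
  · rw [abs_of_nonneg h0] at hε
    obtain ⟨j, hj, m, h1, h2⟩ := h.exists_mem_arc hc hN (orbit α ρ i) (-δ) hε
    exact (hF.lt_of_lt (m := m) (by linarith) (by linarith)).ne' (hp' j hj)
  · rw [abs_of_neg h0] at hε
    obtain ⟨j, hj, m, h1, h2⟩ := h.exists_mem_arc hc hN (orbit α ρ i) 0 hε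
    exact (hF.lt_of_lt (m := m) (by linarith) (by linarith)).ne (hp' j hj)

/-- Two times at which the orbit comes as close to an integer, from the same side, as
`q.den * α` differ by at most `q.den`, unless they are far apart. -/
theorem sub_le_den_of_close {q : ℚ} {k : ℝ} {x : ℝ} {m : ℕ} {a b : ℤ}
    (hq0 : q.den * α - q.num ≠ 0) (hk : (k + 1) * q.den * |q.den * α - q.num| < 1)
    (hm : (m : ℝ) ≤ k * q.den)
    (ha : |x - a| ≤ |q.den * α - q.num|) (ha' : 0 ≤ (a - x) * (q.den * α - q.num))
    (hb : |x + m * α - b| ≤ |q.den * α - q.num|)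
    (hb' : 0 ≤ (b - (x + m * α)) * (q.den * α - q.num)) : m ≤ q.den := by
  set δ := q.den * α - q.num with hδ
  have hδ0 : 0 < |δ| := abs_pos.2 hq0
  have hd0 : (0 : ℝ) < q.den := by exact_mod_cast q.pos
  have hclose : |m * α - (b - a : ℤ)| ≤ |δ| := by
    push_cast
    rcases lt_or_gt_of_ne hq0 with h | h
    · rw [abs_of_neg h] at *
      have h1 : a - x ≤ 0 := by
        by_contra! hlt
        exact absurd ha' (not_le.2 (mul_neg_of_pos_of_neg hlt h))
      have h2 : b - (x + m * α) ≤ 0 := by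
        by_contra! hlt
        exact absurd hb' (not_le.2 (mul_neg_of_pos_of_neg hlt h))
      rw [abs_le] at *
      constructor <;> linarith
    · rw [abs_of_pos h] at *
      have h1 := nonneg_of_mul_nonneg_left ha' h
      have h2 := nonneg_of_mul_nonneg_left hb' h
      rw [abs_le] at *
      constructor <;> linarith
  set r := b - a
  -- This integer equals `q.den * (mα - r) - mδ`, which is smaller than 1 in absolute value.
  have hint : (m : ℤ) * q.num - q.den * r = 0 := by
    have hlt : |((m : ℤ) * q.num - q.den * r : ℝ)| < 1 := by
      have e : ((m : ℤ) * q.num - q.den * r : ℝ) = q.den * (m * α - r) - m * δ := by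
        rw [hδ]
        push_cast
        ring
      rw [e]
      calc |q.den * (m * α - r) - m * δ| ≤ |q.den * (m * α - r)| + |m * δ| := abs_sub _ _
        _ = q.den * |m * α - r| + m * |δ| := by
          rw [abs_mul, abs_mul (m : ℝ), abs_of_pos hd0, abs_of_nonneg (Nat.cast_nonneg m : (0 : ℝ) ≤ m)]
        _ ≤ q.den * |δ| + k * q.den * |δ| := by gcongr
        _ < 1 := by linarith
    have : |(m : ℤ) * q.num - q.den * r| < 1 := by exact_mod_cast hlt
    exact Int.abs_lt_one_iff.1 this
  have hdvd : (q.den : ℤ) ∣ m :=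
    (Rat.isCoprime_num_den q).symm.dvd_of_dvd_mul_right ⟨r, by linarith⟩
  obtain ⟨t, rfl⟩ := Int.natCast_dvd_natCast.1 hdvd
  have hr : r = t * q.num := by
    have hdz : (q.den : ℤ) ≠ 0 := by exact_mod_cast q.den_nz
    apply mul_left_cancel₀ hdz
    push_cast at hint
    linarith
  rw [hr] at hclose
  have e : ((q.den * t : ℕ) : ℝ) * α - (t * q.num : ℤ) = t * δ := by
    rw [hδ]
    push_cast
    ring
  rw [e, abs_mul, abs_of_nonneg (Nat.cast_nonneg t)] at hclose
  have ht : (t : ℝ) ≤ 1 := by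
    by_contra! hlt
    nlinarith
  have ht' : t ≤ 1 := by exact_mod_cast ht
  nlinarith

/-- If `δ = q.den * α - q.num` is tiny, the shift by `δ` matters only at times when the orbit is
within `|δ|` of an integer on one side. Nearby such times are at most `q.den` apart, so a window
avoiding them exists and carries a `k`-power. -/
theorem IsCoding.badlyApproximable (hα : Irrational α) (hF : IsRounding F)
    (hs : IsCoding s α ρ F) (h : BoundedExponent s) : BadlyApproximable α := by
  obtain ⟨k, hk2, hk⟩ := h
  rw [powerFree_iff] at hk
  refine ⟨1 / (k + 2), by positivity, fun n hn p => ?_⟩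
  by_contra! hlt
  have hn0 : (0 : ℝ) < n := by exact_mod_cast hn
  set q : ℚ := (p : ℚ) / (n : ℚ) with hqdef
  have hqr : (q : ℝ) = p / n := by simp [hqdef]
  have hden : q.den ≤ n := by
    have h1 : (q.den : ℤ) ∣ (n : ℤ) := by
      have := Rat.den_dvd p (n : ℤ)
      rwa [Rat.divInt_eq_div, Int.cast_natCast, ← hqdef] at this
    exact Nat.le_of_dvd (by omega) (by exact_mod_cast h1)
  have hd0 : (0 : ℝ) < q.den := by exact_mod_cast q.pos
  have hq0 := natCast_mul_sub_ne_zero hα q.pos q.num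
  have hsmall : (k + 1 + 1) * q.den * |q.den * α - q.num| < 1 := by
    rw [mul_abs_mul_sub_eq hn0, ← hqr] at hlt
    have e : (q.den : ℝ) * |q.den * α - q.num| = q.den ^ 2 * |α - q| := by
      rw [mul_abs_mul_sub_eq hd0]
      congr 3
      exact_mod_cast Rat.num_div_den q
    have hle : (q.den : ℝ) ^ 2 * |α - q| < 1 / (k + 2) := by
      refine lt_of_le_of_lt ?_ hlt
      gcongr
    rw [mul_assoc, e]
    rw [lt_div_iff₀ (by positivity)] at hle
    linarith
  suffices h : ∃ i, ∀ j, j + q.den ≤ k * q.den →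
      F (orbit α ρ (i + j) + (q.den * α - q.num)) = F (orbit α ρ (i + j)) by
    obtain ⟨i, hi⟩ := h
    refine hk i q.den q.pos ((hs.periodicOn_iff _ _ _).2 fun j hj => ?_)
    have h0 := (hF.add_eq_iff _ _ _).2 (hi 0 (by nlinarith [q.pos]))
    have h1 := (hF.add_eq_iff _ _ _).2 (hi j hj)
    rw [add_zero] at h0
    rw [orbit_add _ _ (i + j), orbit_add _ _ i q.den, h1, h0]
  by_contra! hbad
  obtain ⟨j, -, hj⟩ := hbad 0
  rw [zero_add] at hj
  -- Starting the second window `q.den + 1` after the first bad time puts the next one too far away.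
  obtain ⟨j', hj'k, hj'⟩ := hbad (j + q.den + 1)
  rw [show j + q.den + 1 + j' = j + (q.den + 1 + j') by ring, orbit_add] at hj'
  obtain ⟨a, ha, ha'⟩ := hF.exists_int_of_ne hj
  obtain ⟨b, hb, hb'⟩ := hF.exists_int_of_ne hj'
  have hd1 := q.pos
  have := sub_le_den_of_close hq0 hsmall (by
    have : q.den + 1 + j' ≤ (k + 1) * q.den := by linarith
    exact_mod_cast this) ha ha' hb hb'
  omega

/-- A high power of period `n` would contain all factors of length `n`, which would then all have
the same number `p` of letters `a`. So `t(nα - p)` would stay bounded in `t`, against irrationality.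
-/
theorem LinearlyRecurrent.boundedExponent (hα : Irrational α) (hF : IsRounding F)
    (hs : IsCoding s α ρ F) (h : LinearlyRecurrent s) : BoundedExponent s := by
  obtain ⟨K, hK⟩ := linearlyRecurrent_iff.1 h
  refine ⟨max K 2, le_max_right _ _, powerFree_iff.2 fun i n hn hp => ?_⟩
  have hfc := (hK n hn).mono (Nat.mul_le_mul_right n (le_max_left K 2))
  rw [hs.periodicOn_iff] at hp
  obtain ⟨p, hpe⟩ : ∃ p, F (orbit α ρ (i + n)) - F (orbit α ρ i) = p := ⟨_, rfl⟩
  rw [hpe] at hp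
  have hall : ∀ j, F (orbit α ρ (j + n)) - F (orbit α ρ j) = p := by
    intro j
    obtain ⟨l, n', hl, he⟩ := infix_block_iff.1 <|
      hfc _ (isFactor_block s i (max K 2 * n)) (by simp) _ (isFactor_block s j n) (by simp)
    obtain rfl : n = n' := by simpa using congrArg List.length he
    rw [(hs.block_eq_iff _ _ _).1 he n le_rfl, hp l hl]
  have hmul : ∀ t : ℕ, F (orbit α ρ (t * n)) = F (orbit α ρ 0) + t * p := by
    intro t
    induction t with
    | zero => simp
    | succ t ih =>
      have := hall (t * n)
      rw [Nat.add_mul, one_mul]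
      push_cast
      linarith
  have hδ := abs_pos.2 (natCast_mul_sub_ne_zero hα hn p)
  obtain ⟨t, ht⟩ := exists_nat_gt (2 / |(n : ℝ) * α - p|)
  rw [div_lt_iff₀ hδ] at ht
  have h1 := hF.abs_sub_le (orbit α ρ (t * n))
  have h2 := hF.abs_sub_le (orbit α ρ 0)
  have h3 : (F (orbit α ρ (t * n)) : ℝ) = F (orbit α ρ 0) + t * p := by exact_mod_cast hmul t
  have h4 := orbit_add α ρ 0 (t * n)
  rw [zero_add] at h4
  push_cast at h4
  have h5 : |(t : ℝ) * (n * α - p)| ≤ 2 := by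
    rw [h3, h4] at h1
    rw [abs_le] at *
    constructor <;> linarith
  rw [abs_mul, abs_of_nonneg (Nat.cast_nonneg t)] at h5
  linarith

/-- On one side of any point, `F` has the same increments along the orbits of length `n` of all
points at distance less than `c / (2 * n)`. -/
theorem BadlyApproximableWith.increments_eq {c : ℝ} (hc : 0 < c)
    (h : BadlyApproximableWith α c) (hF : IsRounding F) {n : ℕ} (hn : 1 ≤ n) (x : ℝ) :
    (∀ y, x < y → y < x + c / n / 2 → ∀ l ≤ n, F (y + l * α) = F (x + l * α)) ∨
      ∀ y, x - c / n / 2 < y → y < x → ∀ l ≤ n, F (y + l * α) = F (x + l * α) := by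
  have hn0 : (0 : ℝ) < n := by exact_mod_cast hn
  have hcn : c / n ≤ 1 := by
    have h1 := h.div_le hn ⌊n * α⌋
    rw [Int.self_sub_floor, abs_of_nonneg (Int.fract_nonneg _)] at h1
    exact h1.trans (Int.fract_lt_one _).le
  -- The cut points `m - lα` with distinct `l ≤ n` are at least `c/n` apart.
  have key : ∀ l ≤ n, ∀ l' ≤ n, ∀ m m' : ℤ, |((m : ℝ) - l * α) - (m' - l' * α)| < c / n →
      l = l' := by
    intro l hl l' hl' m m' hlt
    by_contra hne
    wlog hll : l' < l generalizing l l' m m'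
    · exact this l' hl' l hl m' m (by rwa [abs_sub_comm]) (Ne.symm hne) (by omega)
    obtain ⟨r, rfl⟩ := Nat.exists_eq_add_of_lt hll
    have h1 := h.div_le (n := r + 1) (by omega) (m - m')
    have h2 : c / n ≤ c / (r + 1 : ℕ) := by
      have : ((r + 1 : ℕ) : ℝ) ≤ n := by exact_mod_cast (by omega : r + 1 ≤ n)
      gcongr
    rw [abs_sub_comm] at h1
    have e : ((m : ℝ) - ((l' + r + 1 : ℕ) : ℝ) * α) - (m' - l' * α) =
        ((m - m' : ℤ) : ℝ) - ((r + 1 : ℕ) : ℝ) * α := by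
      push_cast
      ring
    rw [e] at hlt
    linarith
  by_contra! hcon
  obtain ⟨⟨y, hxy, hy, l, hl, hne⟩, z, hz, hzx, l', hl', hne'⟩ := hcon
  have hlt : F (x + l * α) < F (y + l * α) :=
    lt_of_le_of_ne (hF.mono (by linarith)) (Ne.symm hne)
  have hlt' : F (z + l' * α) < F (x + l' * α) :=
    lt_of_le_of_ne (hF.mono (by linarith)) hne'
  obtain ⟨m, hm1, hm2⟩ := hF.exists_int hlt
  obtain ⟨m', hm1', hm2'⟩ := hF.exists_int hlt'
  -- Failure on both sides happens at the same `l`, so `F` jumps twice over a length below 1, which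
  -- is impossible.
  obtain rfl := key l hl l' hl' m m' (by rw [abs_lt]; constructor <;> linarith)
  have h1 := hF.map_add_int (z + l * α) 1
  have h2 : F (y + l * α) ≤ F (z + l * α + (1 : ℤ)) := hF.mono (by push_cast; linarith)
  omega

/-- A Sturmian word of badly approximable angle is linearly recurrent. -/
theorem IsCoding.linearlyRecurrent (hF : IsRounding F) (hs : IsCoding s α ρ F)
    (h : BadlyApproximable α) : LinearlyRecurrent s := by
  obtain ⟨c, hc, h⟩ := h
  obtain ⟨k, hk⟩ := exists_nat_gt (4 / c / (c / 2))
  have hk0 : (0 : ℝ) < k := lt_trans (by positivity) hk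
  refine linearlyRecurrent_iff.2 ⟨k + 1, fun n hn => ?_⟩
  rintro v ⟨j, m, rfl⟩ hm u ⟨i, n', rfl⟩ hn'
  rw [length_block] at hm hn'
  subst hm hn'
  have hn0 : (0 : ℝ) < n' := by exact_mod_cast hn
  have hN : 1 ≤ k * n' := Nat.mul_pos (by exact_mod_cast hk0) hn
  have hε : 4 / c / ((k * n' : ℕ) : ℝ) ≤ c / n' / 2 := by
    rw [div_lt_iff₀ (by positivity)] at hk
    push_cast
    rw [div_div c, div_le_div_iff₀ (by positivity) (by positivity)]
    have := mul_lt_mul_of_pos_right hk hn0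
    nlinarith
  -- It is enough to enter, within `k * n'` steps, the one-sided arc at `orbit α ρ i` on which the
  -- coding reads `u`; reading `u` takes `n'` more letters.
  suffices h : ∃ t < k * n', ∃ r : ℤ, ∀ l ≤ n',
      F (orbit α ρ j + t * α - r + l * α) = F (orbit α ρ i + l * α) by
    obtain ⟨t, ht, r, htr⟩ := h
    refine infix_block_iff.2 ⟨t, n', by linarith, (hs.block_eq_iff _ _ _).2 fun l hl => ?_⟩
    have aux : ∀ l ≤ n', F (orbit α ρ (j + t + l)) = F (orbit α ρ (i + l)) + r := by
      intro l hl
      have h1 := hF.map_add_int (orbit α ρ j + t * α - r + l * α) r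
      rw [htr l hl, ← orbit_add α ρ i l] at h1
      rw [← h1, orbit_add, orbit_add]
      congr 1
      ring
    have h0 := aux 0 (Nat.zero_le _)
    simp only [add_zero] at h0
    rw [aux l hl, h0]
    ring
  rcases h.increments_eq hc hF hn (orbit α ρ i) with hside | hside
  · obtain ⟨t, ht, r, h1, h2⟩ := h.exists_mem_arc hc hN (orbit α ρ j) (orbit α ρ i) hε
    exact ⟨t, ht, r, hside _ h1 h2⟩
  · obtain ⟨t, ht, r, h1, h2⟩ := h.exists_mem_arc hc hN (orbit α ρ j)
      (orbit α ρ i - c / n' / 2) hε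
    exact ⟨t, ht, r, hside _ h1 (by linarith)⟩

end Recurrence

end AbSq

namespace AbSq

/-! ### Counting abelian squares -/

section AbelianSquares

variable {s : ℕ → Letter} {α ρ : ℝ} {F : ℝ → ℤ}

theorem length_eq_count_add_count (v : List Letter) :
    v.length = v.count Letter.a + v.count Letter.b := by
  induction v with
  | nil => rfl
  | cons x v ih =>
    rcases x <;> simp [ih] <;> omega

theorem IsCoding.isAbelianSquare_block (hs : IsCoding s α ρ F) {i m : ℕ} (hm : 1 ≤ m)
    (h : F (orbit α ρ (i + m)) - F (orbit α ρ i) =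
      F (orbit α ρ (i + m + m)) - F (orbit α ρ (i + m))) :
    IsAbelianSquare (block s i (2 * m)) := by
  refine ⟨?_, block s i m, block s (i + m) m, by rw [two_mul, block_add], ?_⟩
  · rw [← List.length_pos_iff, length_block]
    omega
  · have h1 := hs.add_count i m
    have h2 := hs.add_count (i + m) m
    have h3 := length_eq_count_add_count (block s i m)
    have h4 := length_eq_count_add_count (block s (i + m) m)
    rw [length_block] at h3 h4
    funext x
    rcases x <;> simp only [parikh] <;> omega

theorem IsRounding.eq_of_mem_Ioo (hF : IsRounding F) {x y : ℝ} (hx : x ∈ Set.Ioo (0 : ℝ) 1)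
    (hy : y ∈ Set.Ioo (0 : ℝ) 1) : F x = F y := by
  wlog hlt : F x < F y generalizing x y
  · by_contra hne
    rcases lt_or_gt_of_ne hne with h | h
    · exact hne (this hx hy h)
    · exact hne (this hy hx h).symm
  obtain ⟨m, h1, h2⟩ := hF.exists_int hlt
  have h3 : (0 : ℝ) < m := hx.1.trans_le h1
  have h4 : (m : ℝ) < 1 := h2.trans_lt hy.2
  have h3' : 0 < m := by exact_mod_cast h3
  have h4' : m < 1 := by exact_mod_cast h4
  omega

/-- If `m * α` is within `1 / 4` of an integer, then the blocks of length `2 * m` read from the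
points of some arc of length `1 / 2` are abelian squares. -/
theorem IsRounding.exists_arc_of_close (hF : IsRounding F) {θ : ℝ} {M : ℤ}
    (h : |θ - M| ≤ 1 / 4) :
    ∃ y : ℝ, 0 ≤ y ∧ y ≤ 1 / 2 ∧ ∀ x, y < x → x < y + 1 / 2 →
      F (x + θ) - F x = F (x + θ + θ) - F (x + θ) := by
  have key : ∀ x, x ∈ Set.Ioo (0 : ℝ) 1 → x + (θ - M) ∈ Set.Ioo (0 : ℝ) 1 →
      x + (θ - M) + (θ - M) ∈ Set.Ioo (0 : ℝ) 1 →
      F (x + θ) - F x = F (x + θ + θ) - F (x + θ) := by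
    intro x h0 h1 h2
    have e1 := hF.map_add_int (x + (θ - M)) M
    have e2 := hF.map_add_int (x + (θ - M) + (θ - M)) (M + M)
    rw [show x + (θ - M) + (M : ℝ) = x + θ by ring, hF.eq_of_mem_Ioo h1 h0] at e1
    rw [show x + (θ - M) + (θ - M) + ((M + M : ℤ) : ℝ) = x + θ + θ by push_cast; ring,
      hF.eq_of_mem_Ioo h2 h0] at e2
    rw [e1, e2]
    ring
  rw [abs_le] at h
  -- Two steps drift by at most `1/2`, so starting in the half opposite to the drift keeps all three
  -- points in `(0, 1)`, where `F` is constant.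
  rcases le_total 0 (θ - M) with h0 | h0
  · refine ⟨0, le_rfl, by norm_num, fun x h1 h2 => key x ?_ ?_ ?_⟩ <;>
      constructor <;> linarith
  · refine ⟨1 / 2, by norm_num, le_rfl, fun x h1 h2 => key x ?_ ?_ ?_⟩ <;>
      constructor <;> linarith

/-- A Sturmian word of badly approximable angle has many abelian squares of length `2 * m` if
`m * α` is within `1 / 4` of an integer. -/
theorem IsCoding.exists_finset_isAbelianSquare {c : ℝ} (hc : 0 < c)
    (h : BadlyApproximableWith α c) (hF : IsRounding F) (hs : IsCoding s α ρ F) {m T : ℕ}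
    (hm : 1 ≤ m) (hT : 4 * (4 / c) * T ≤ m) {M : ℤ} (hM : |m * α - M| ≤ 1 / 4) :
    ∃ S : Finset (List Letter), S.card = T ∧
      ∀ u ∈ S, IsFactor u s ∧ IsAbelianSquare u ∧ u.length = 2 * m := by
  classical
  have hm0 : (0 : ℝ) < m := by exact_mod_cast hm
  obtain ⟨y, hy0, hy1, hy⟩ := hF.exists_arc_of_close hM
  -- The arc is cut into `2T` cells of length `ε`: cells `2r` provide starting points, and each cell
  -- `2r + 1` contains a cut point `n - lα` that makes the blocks on its two sides differ.
  set ε := 4 / c / m with hε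
  have hε0 : 0 < ε := by positivity
  have hεT : 2 * T * ε ≤ 1 / 2 := by
    rw [hε, ← mul_div_assoc, div_le_iff₀ hm0]
    linarith
  have h1 : ∀ r : ℕ, ∃ (i : ℕ) (k : ℤ), y + 2 * r * ε < orbit α ρ i - k ∧
      orbit α ρ i - k < y + (2 * r + 1) * ε := by
    intro r
    obtain ⟨i, -, k, h1, h2⟩ := h.exists_mem_arc hc hm ρ (y + 2 * r * ε) le_rfl
    exact ⟨i, k, h1, h2.trans_le (by linarith)⟩
  choose i k hik hik' using h1
  have h2 : ∀ r : ℕ, ∃ l : ℕ, l < m ∧ ∃ n : ℤ, y + (2 * r + 1) * ε < n - l * α ∧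
      n - l * α < y + (2 * r + 2) * ε := by
    intro r
    obtain ⟨l, hl, n, h1, h2⟩ := h.exists_mem_arc hc hm 0 (-(y + (2 * r + 2) * ε)) le_rfl
    exact ⟨l, hl, n, by linarith, by linarith⟩
  have hrT : ∀ r < T, (2 * r + 2) * ε ≤ 1 / 2 := by
    intro r hr
    have : (r : ℝ) + 1 ≤ T := by exact_mod_cast hr
    nlinarith
  have hmem : ∀ r < T, y < orbit α ρ (i r) - k r ∧ orbit α ρ (i r) - k r < y + 1 / 2 := by
    intro r hr
    have h3 := hik r
    have h4 := hik' r
    have h5 := hrT r hr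
    constructor
    · have : 0 ≤ 2 * (r : ℝ) * ε := by positivity
      linarith
    · linarith
  have hshift : ∀ r (x : ℝ), F (orbit α ρ (i r) + x) = F (orbit α ρ (i r) - k r + x) + k r := by
    intro r x
    rw [← hF.map_add_int]
    congr 1
    ring
  have hne : ∀ r r' : ℕ, r < r' → r' < T →
      block s (i r) (2 * m) ≠ block s (i r') (2 * m) := by
    intro r r' hr hr' heq
    obtain ⟨l, hl, n, hn, hn'⟩ := h2 r
    have h3 := (hs.block_eq_iff _ _ _).1 heq l (by omega)
    have h0 := hshift r 0
    have h0' := hshift r' 0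
    rw [add_zero, add_zero] at h0 h0'
    rw [orbit_add, orbit_add, hshift, hshift, h0, h0'] at h3
    obtain ⟨ha, hb⟩ := hmem r (hr.trans hr')
    obtain ⟨ha', hb'⟩ := hmem r' hr'
    have h4 : F (orbit α ρ (i r) - k r) = F (orbit α ρ (i r') - k r') :=
      hF.eq_of_mem_Ioo ⟨by linarith, by linarith⟩ ⟨by linarith, by linarith⟩
    have h5 : F (orbit α ρ (i r) - k r + l * α) < F (orbit α ρ (i r') - k r' + l * α) := by
      have h6 := hik' r
      have h7 := hik r'
      have h8 : (r : ℝ) + 1 ≤ r' := by exact_mod_cast hr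
      have h9 : (2 * (r : ℝ) + 2) * ε ≤ 2 * r' * ε :=
        mul_le_mul_of_nonneg_right (by linarith) hε0.le
      exact hF.lt_of_lt (m := n) (by linarith) (by linarith)
    omega
  refine ⟨(Finset.range T).image fun r => block s (i r) (2 * m), ?_, ?_⟩
  · rw [Finset.card_image_of_injOn, Finset.card_range]
    intro r hr r' hr' heq
    rw [Finset.mem_coe, Finset.mem_range] at hr hr'
    rcases lt_trichotomy r r' with hlt | rfl | hlt
    · exact absurd heq (hne r r' hlt hr')
    · rfl
    · exact absurd heq.symm (hne r' r hlt hr)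
  · intro u hu
    obtain ⟨r, hr, rfl⟩ := Finset.mem_image.1 hu
    rw [Finset.mem_range] at hr
    refine ⟨isFactor_block _ _ _, hs.isAbelianSquare_block hm ?_, by simp⟩
    obtain ⟨ha, hb⟩ := hmem r hr
    have h3 := hy _ ha hb
    have h0 := hshift r 0
    rw [add_zero, add_zero] at h0
    have h4 := hshift r (m * α)
    have h5 := hshift r (m * α + m * α)
    rw [← add_assoc, ← add_assoc] at h5
    rw [orbit_add _ _ (i r + m), orbit_add, h5, h4, h0]
    linarith

theorem IsCoding.sq_le_abelianSquareCount {c : ℝ} (hc : 0 < c)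
    (h : BadlyApproximableWith α c) (hF : IsRounding F) (hs : IsCoding s α ρ F) {K W T L : ℕ}
    (hK : ∀ n, 1 ≤ n → FactorsContain s (K * n) n) (hW : 4 * (4 / c) ≤ W) (hT : 1 ≤ T)
    (hL : 4 * K * W * T ≤ L) (i : ℕ) : T * T ≤ abelianSquareCount (block s i L) := by
  have hW0 : (0 : ℝ) < W := lt_of_lt_of_le (by positivity) hW
  have hW1 : 1 ≤ W := by exact_mod_cast hW0
  -- Among `W ≥ 16/c` consecutive multiples of `α`, one falls in the arc of length `1/2` around the
  -- integers. This yields `T` half-lengths between `WT` and `2WT`.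
  have h1 : ∀ r : ℕ, ∃ j < W, ∃ M : ℤ, |((W * (T + r) + j : ℕ) : ℝ) * α - M| ≤ 1 / 4 := by
    intro r
    have hε : 4 / c / W ≤ 1 / 2 := by
      rw [div_le_iff₀ hW0]
      have : 0 < 4 / c := by positivity
      linarith
    obtain ⟨j, hj, M, h1, h2⟩ :=
      h.exists_mem_arc hc hW1 (((W * (T + r) : ℕ) : ℝ) * α) (-(1 / 4)) hε
    refine ⟨j, hj, M, ?_⟩
    rw [Nat.cast_add, add_mul, abs_le]
    constructor <;> linarith
  choose j hj M hM using h1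
  set m : ℕ → ℕ := fun r => W * (T + r) + j r with hm
  have hm1 : ∀ r, W * T ≤ m r := fun r => by
    simp only [hm]
    nlinarith [Nat.zero_le (W * r)]
  have hcount : ∀ r < T, 2 * m r ≤ L ∧
      T ≤ abelianSquareCountLength (block s i L) (2 * m r) := by
    intro r hr
    have hpos : 1 ≤ m r := le_trans (Nat.mul_pos hW1 hT) (hm1 r)
    have hT' : 4 * (4 / c) * T ≤ m r := by
      have : ((W * T : ℕ) : ℝ) ≤ m r := by exact_mod_cast hm1 r
      push_cast at this
      exact (mul_le_mul_of_nonneg_right hW (Nat.cast_nonneg T)).trans this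
    obtain ⟨S, hST, hS⟩ := hs.exists_finset_isAbelianSquare hc h hF hpos hT' (hM r)
    have hlen : K * (2 * m r) ≤ L := by
      have h3 : m r ≤ 2 * (W * T) := by
        have : W * (r + 1) ≤ W * T := Nat.mul_le_mul_left W hr
        have := hj r
        simp only [hm]
        nlinarith
      calc K * (2 * m r) ≤ K * (2 * (2 * (W * T))) := by gcongr
        _ = 4 * K * W * T := by ring
        _ ≤ L := hL
    have hfc := (hK (2 * m r) (by omega)).mono hlen
    have hsub : (S : Set (List Letter)) ⊆ abelianSquareFactors (block s i L) (2 * m r) := by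
      intro u hu
      obtain ⟨hu1, hu2, hu3⟩ := hS u hu
      exact ⟨hfc _ (isFactor_block s i L) (by simp) u hu1 hu3, hu2, hu3⟩
    constructor
    · obtain ⟨u, hu⟩ : S.Nonempty := Finset.card_pos.1 (by omega)
      obtain ⟨hu1, -, hu3⟩ := hsub hu
      simpa [hu3] using hu1.length_le
    · rw [← hST, ← Set.ncard_coe_finset]
      exact Set.ncard_le_ncard hsub (finite_abelianSquareFactors _ _)
  -- Each half-length lies in its own interval of length `W`, so dividing by `W` recovers `r`.
  have hinj : Set.InjOn (fun r => 2 * m r) (Finset.range T) := by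
    have hdiv : ∀ r, m r / W = T + r := fun r => by
      simp only [hm]
      rw [Nat.mul_add_div hW1, Nat.div_eq_of_lt (hj r), add_zero]
    intro r _ r' _ heq
    have h1 : m r = m r' := Nat.eq_of_mul_eq_mul_left two_pos heq
    have h2 := hdiv r
    rw [h1, hdiv r'] at h2
    omega
  calc T * T = ∑ _r ∈ Finset.range T, T := by simp
    _ ≤ ∑ r ∈ Finset.range T, abelianSquareCountLength (block s i L) (2 * m r) :=
      Finset.sum_le_sum fun r hr => (hcount r (Finset.mem_range.1 hr)).2
    _ = ∑ n ∈ (Finset.range T).image fun r => 2 * m r,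
        abelianSquareCountLength (block s i L) n := by rw [Finset.sum_image hinj]
    _ ≤ abelianSquareCount (block s i L) := by
      refine Finset.sum_le_sum_of_subset fun n hn => ?_
      obtain ⟨r, hr, rfl⟩ := Finset.mem_image.1 hn
      have := (hcount r (Finset.mem_range.1 hr)).1
      rw [Finset.mem_range, length_block]
      omega

theorem IsCoding.uniformlyAbelianSquareRich (hF : IsRounding F) (hs : IsCoding s α ρ F)
    (h : BadlyApproximable α) : UniformlyAbelianSquareRich s := by
  obtain ⟨K, hK⟩ := linearlyRecurrent_iff.1 (hs.linearlyRecurrent hF h)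
  obtain ⟨c, hc, h⟩ := h
  obtain ⟨W, hW⟩ := exists_nat_ge (4 * (4 / c))
  have hK' : ∀ n, 1 ≤ n → FactorsContain s ((K + 1) * n) n := fun n hn =>
    (hK n hn).mono (by nlinarith)
  have hW0 : (0 : ℝ) < W := lt_of_lt_of_le (by positivity) hW
  have hW1 : 0 < W := by exact_mod_cast hW0
  set Q := 4 * (K + 1) * W with hQ
  have hQ0 : 0 < Q := by positivity
  have hQr : (0 : ℝ) < Q := by exact_mod_cast hQ0
  -- With `T = L / Q`, the bound `L ≥ Q` gives `L ≤ 2QT`, hence `T² ≥ L²/(2Q)²`.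
  refine ⟨1 / (2 * Q) ^ 2, by positivity, Q, ?_⟩
  rintro v ⟨i, L, rfl⟩ hL
  rw [length_block] at hL ⊢
  have hT : 1 ≤ L / Q := Nat.div_pos hL hQ0
  have hcount := hs.sq_le_abelianSquareCount hc h hF hK' hW hT (Nat.mul_div_le L Q) i
  have hLT : (L : ℝ) ≤ 2 * Q * (L / Q : ℕ) := by
    have h1 := Nat.div_add_mod L Q
    have h2 := Nat.mod_lt L hQ0
    have h3 : L ≤ 2 * Q * (L / Q) := by nlinarith
    exact_mod_cast h3
  have hcount' : ((L / Q : ℕ) : ℝ) * (L / Q : ℕ) ≤ abelianSquareCount (block s i L) := by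
    exact_mod_cast hcount
  refine le_trans ?_ hcount'
  rw [one_div, inv_mul_le_iff₀ (by positivity)]
  calc (L : ℝ) ^ 2 ≤ (2 * Q * (L / Q : ℕ)) ^ 2 := by gcongr
    _ = _ := by ring

end AbelianSquares

end AbSq

theorem mainTheorem2 (α : ℝ) (s : ℕ → AbSq.Letter) (hs : AbSq.IsSturmianOfAngle s α) :
    (AbSq.BoundedExponent s ↔ AbSq.UniformlyAbelianSquareRich s) ∧
      (AbSq.BoundedExponent s ↔ AbSq.BoundedPartialQuotients α) ∧
      (AbSq.BoundedExponent s ↔ AbSq.LinearlyRecurrent s) := by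
  have hα : Irrational α := hs.1
  obtain ⟨ρ, F, hF, hc⟩ := hs.exists_isCoding
  have hBA : AbSq.BoundedExponent s ↔ AbSq.BadlyApproximable α :=
    ⟨hc.badlyApproximable hα hF, hc.boundedExponent hF⟩
  refine ⟨⟨fun h => hc.uniformlyAbelianSquareRich hF (hBA.1 h), fun h => h.boundedExponent⟩,
    hBA.trans (AbSq.badlyApproximable_iff_boundedPartialQuotients hα),
    ⟨fun h => hc.linearlyRecurrent hF (hBA.1 h), fun h => h.boundedExponent hα hF hc⟩⟩
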